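/- Let $n$ be the number of independent variables $x=(x^1,\dots,x^n)$, and let $u$ be a single dependent variable. Let $\Omega$ be an open subset of the jet space with coordinates $x$ and $u_J$, where $J=(j_1,\dots,j_n)\in\mathbb{N}^n$ and $u_0=u$; the jet space carries the product topology, and the case $\Omega=$ the whole jet space is included. A *differential function* is a smooth real function on $\Omega$ of $x$ and finitely many of the $u_J$. Write $D_i=\partial_{x^i}+\sum_J u_{J+e_i}\partial_{u_J}$ for the total derivatives, $D_J=D_1^{j_1}\cdots D_n^{j_n}$, $G'(P)=\sum_J G_{u_J}D_JP$ for the Fréchet derivative, and $E_u(L)=\sum_J(-1)^{|J|}D_J(L_{u_J})$ for the Euler–Lagrange operator. Let $G$ be a differential function, and let $\mathcal{E}\subset\Omega$ be the space of formal solutions of $G=0$, that is, the set of points at which $D_KG=0$ for all $K$. A *symmetry* of $G=0$ is a differential function $P$ with $G'(P)|_{\mathcal{E}}=0$. The equation $G=0$ is *Euler–Lagrange* if $G=E_u(L)$ for some differential function $L$; in that case a symmetry $P$ is *variational* if $E_u(PG)\equiv 0$. A *variational integrating factor* of $G$ is a differential function $W\not\equiv 0$ such that $WG=E_u(\tilde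 L)$ for some differential function $\tilde L$. A *multiplicative recursion operator* for the symmetries of $G=0$ is a differential function $W$ such that $WP$ is a symmetry whenever $P$ is; it is *trivial* if $W$ is constant. **Proposition.** Suppose that $G=0$ is an Euler–Lagrange equation, and that $$X=\sum_i\xi^i(x,u)\,\partial_{x^i}+\eta(x,u)\,\partial_u,$$ with $\xi^i$, $\eta$ smooth, is a Lie point symmetry of it, meaning that its characteristic function $P=\eta-\sum_i\xi^iu_{x^i}$ is a symmetry. Suppose that this symmetry is non-variational, and that $f$ is a differential function with $$\mathrm{pr}\,X(G)=fG\ \text{ on }\Omega,\qquad\text{where}\quad \mathrm{pr}\,X(G)=G'(P)+\sum_i\xi^iD_iG .$$ Then $$W=f+\eta_u+\sum_i\xi^i_{x^i}$$ is a variational integrating factor of $G$. If moreover $W$ is non-constant on $\Omega$, then $W$ is a non-trivial multiplicative recursion operator for the symmetries of $G=0$. -/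

import Mathlib

open scoped ContDiff

noncomputable section

namespace JetPDE

/-- Jet space of one dependent variable `u` over `n` independent variables. A point is
`(x, (u_J)_J)`: the independent variables together with one coordinate `u_J` for every (unordered)
multi-index `J`, where `J i` counts the derivatives in the `i`-th direction, so that `u_0` is `u`
itself. It carries the product topology. -/
abbrev Jet (n : ℕ) : Type := (Fin n → ℝ) × ((Fin n → ℕ) → ℝ)

variable {n : ℕ}

/-- The coordinates `x` and `u_J`, `J ∈ s`, of a point of jet space. -/
def finiteJet (s : Finset (Fin n → ℕ)) (z : Jet n) : (Fin n → ℝ) × (s → ℝ) :=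
  (z.1, fun J => z.2 J)

/-- The coordinates `(x, u)` of a point of jet space. -/
def basePoint (z : Jet n) : (Fin n → ℝ) × ℝ := (z.1, z.2 0)

/-- `f` is a differential function on `Ω`: a smooth function of `x` and of finitely many of the
derivatives of `u`. (The values of `f` outside `Ω` are irrelevant.) -/
def IsDiffFun (Ω : Set (Jet n)) (f : Jet n → ℝ) : Prop :=
  ∃ (s : Finset (Fin n → ℕ)) (g : (Fin n → ℝ) × (s → ℝ) → ℝ),
    ContDiffOn ℝ ∞ g (finiteJet s '' Ω) ∧ ∀ z ∈ Ω, f z = g (finiteJet s z)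

/-- The partial derivative `∂f/∂x^i`, all `u_J` being held fixed. -/
def partialX (i : Fin n) (f : Jet n → ℝ) : Jet n → ℝ :=
  fun z => deriv (fun t => f (Function.update z.1 i t, z.2)) (z.1 i)

/-- The partial derivative `∂f/∂u_J`. -/
def partialU (J : Fin n → ℕ) (f : Jet n → ℝ) : Jet n → ℝ :=
  fun z => deriv (fun t => f (z.1, Function.update z.2 J t)) (z.2 J)

/-- The total derivative `D_i f = ∂f/∂x^i + ∑_J u_{J,i} ∂f/∂u_J`. For a differential function only
finitely many terms are nonzero. -/
def totalDeriv (i : Fin n) (f : Jet n → ℝ) : Jet n → ℝ :=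
  fun z => partialX i f z + ∑ᶠ J : Fin n → ℕ, z.2 (J + Pi.single i 1) * partialU J f z

/-- The iterated total derivative `D_J`, in which each `D_i` occurs `J i` times. -/
def iterTotalDeriv (J : Fin n → ℕ) (f : Jet n → ℝ) : Jet n → ℝ :=
  (List.finRange n).foldr (fun i g => (totalDeriv i)^[J i] g) f

/-- The Frechet derivative `G'(P) = ∑_J (∂G/∂u_J) D_J P`, that is, `pr (P ∂_u) (G)`. -/
def frechet (G P : Jet n → ℝ) : Jet n → ℝ :=
  fun z => ∑ᶠ J : Fin n → ℕ, partialU J G z * iterTotalDeriv J P z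

/-- The Euler-Lagrange operator `E_u(L) = ∑_J (-1)^|J| D_J (∂L/∂u_J)`. -/
def eulerOp (L : Jet n → ℝ) : Jet n → ℝ :=
  fun z => ∑ᶠ J : Fin n → ℕ, (-1 : ℝ) ^ (∑ i, J i) * iterTotalDeriv J (partialU J L) z

/-- `G = 0` is an Euler-Lagrange equation on `Ω`: `G = E_u(L)` for some differential function
`L`. -/
def IsEulerLagrange (Ω : Set (Jet n)) (G : Jet n → ℝ) : Prop :=
  ∃ L, IsDiffFun Ω L ∧ ∀ z ∈ Ω, eulerOp L z = G z

/-- The space of formal solutions of `G = 0`: a formal power series at `x`, with derivatives `u_J`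
there, solves the equation iff `G` and all of its total derivatives vanish at `(x, (u_J)_J)`. -/
def formalSolutions (Ω : Set (Jet n)) (G : Jet n → ℝ) : Set (Jet n) :=
  {z | z ∈ Ω ∧ ∀ K : Fin n → ℕ, iterTotalDeriv K G z = 0}

/-- `P ∂_u` is a symmetry (in characteristic form) of `G = 0`: `G'(P)` vanishes on the space of
formal solutions. -/
def IsSymmetry (Ω : Set (Jet n)) (G P : Jet n → ℝ) : Prop :=
  IsDiffFun Ω P ∧ ∀ z ∈ formalSolutions Ω G, frechet G P z = 0

/-- `P ∂_u` is a variational symmetry of the Euler-Lagrange equation `G = 0`: a symmetry with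
`E_u(P G) ≡ 0`. -/
def IsVariationalSymmetry (Ω : Set (Jet n)) (G P : Jet n → ℝ) : Prop :=
  IsSymmetry Ω G P ∧ ∀ z ∈ Ω, eulerOp (fun y => P y * G y) z = 0

/-- The characteristic function `P = η(x,u) - ξ^i(x,u) u_{x^i}` of the vector field
`ξ^i(x,u) ∂_{x^i} + η(x,u) ∂_u`. -/
def pointCharacteristic (ξ : Fin n → (Fin n → ℝ) × ℝ → ℝ) (η : (Fin n → ℝ) × ℝ → ℝ) :
    Jet n → ℝ :=
  fun z => η (basePoint z) - ∑ i, ξ i (basePoint z) * z.2 (Pi.single i 1)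

/-- The prolongation `pr X = pr (P ∂_u) + ξ^i D_i` of `X = ξ^i ∂_{x^i} + η ∂_u`, with
characteristic function `P`, acting on a differential function `G`. -/
def prolongation (ξ : Fin n → (Fin n → ℝ) × ℝ → ℝ) (η : (Fin n → ℝ) × ℝ → ℝ)
    (G : Jet n → ℝ) : Jet n → ℝ :=
  fun z => frechet G (pointCharacteristic ξ η) z + ∑ i, ξ i (basePoint z) * totalDeriv i G z

/-- `X = ξ^i(x,u) ∂_{x^i} + η(x,u) ∂_u`, with smooth coefficients, is a Lie point symmetry of
`G = 0`. -/
def IsLiePointSymmetry (Ω : Set (Jet n)) (G : Jet n → ℝ)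
    (ξ : Fin n → (Fin n → ℝ) × ℝ → ℝ) (η : (Fin n → ℝ) × ℝ → ℝ) : Prop :=
  (∀ i, ContDiffOn ℝ ∞ (ξ i) (basePoint '' Ω)) ∧ ContDiffOn ℝ ∞ η (basePoint '' Ω) ∧
    IsSymmetry Ω G (pointCharacteristic ξ η)

/-- `W` is a variational integrating factor of `G`: a differential function `W ≢ 0` such that
`W G = E_u(L)` for some differential function `L`. -/
def IsVariationalIntegratingFactor (Ω : Set (Jet n)) (G W : Jet n → ℝ) : Prop :=
  IsDiffFun Ω W ∧ (∃ z ∈ Ω, W z ≠ 0) ∧ IsEulerLagrange Ω (fun z => W z * G z)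

/-- `W` is constant on `Ω`. -/
def IsConstOn (Ω : Set (Jet n)) (W : Jet n → ℝ) : Prop := ∃ c : ℝ, ∀ z ∈ Ω, W z = c

/-- `W` is a multiplicative recursion operator for the symmetries of `G = 0`: multiplication by
`W` maps symmetries to symmetries. -/
def IsMultiplicativeRecursionOperator (Ω : Set (Jet n)) (G W : Jet n → ℝ) : Prop :=
  IsDiffFun Ω W ∧ ∀ P, IsSymmetry Ω G P → IsSymmetry Ω G (fun z => W z * P z)

/-- A multiplicative recursion operator is trivial if it is a constant. -/
def IsNontrivialMultiplicativeRecursionOperator (Ω : Set (Jet n)) (G W : Jet n → ℝ) : Prop :=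
  IsMultiplicativeRecursionOperator Ω G W ∧ ¬ IsConstOn Ω W

/-- The function `W = f + η_u + ξ^i_{x^i}` (with explicit partial derivatives of the functions
`η(x,u)` and `ξ^i(x,u)`). -/
def integratingFactor (ξ : Fin n → (Fin n → ℝ) × ℝ → ℝ) (η : (Fin n → ℝ) × ℝ → ℝ)
    (f : Jet n → ℝ) : Jet n → ℝ :=
  fun z => f z + partialU 0 (fun y => η (basePoint y)) z
    + ∑ i, partialX i (fun y => ξ i (basePoint y)) z

end JetPDE

end

noncomputable section

namespace JetPDE

/-! Write `F'^*` for the formal adjoint of `F'`. The Lagrangian for `W G` is `P G`. The product rule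
gives `E(PG) = G'^*(P) + P'^*(G)` (`euler_mul`). As `G` is Euler–Lagrange, `G'^* = G'` (Helmholtz,
`fre_euler`), and since `P` is first order, `P'^*(G) = ξ^i D_i G + (η_u + ξ^i_{x^i}) G`. By the
hypothesis on `f` the sum is `W G` (`euler_characteristic_mul`). If `W` vanished on `Ω`, so would
`E(PG)`, and the symmetry would be variational.

For the recursion property, both `G'` and `(WG)'` are self-adjoint, so `W G'(Q) + G W'(Q) = G'(WQ) +
W'^*(GQ)`. At a formal solution the left side vanishes if `Q` is a symmetry, and `W'^*(GQ)` is built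
from total derivatives of a multiple of `G`; hence `G'(WQ) = 0` (`eval_fre_mul`).

All this is algebra of commuting derivations, done in an abstract `JetCalculus`. Analysis enters
only in showing that smooth functions on an open `Ω` form one. -/

/-- Induction on multi-indices, raising one entry at a time. -/
theorem multiIndex_induction {n : ℕ} {p : (Fin n → ℕ) → Prop} (zero : p 0)
    (succ : ∀ J i, p J → p (J + Pi.single i 1)) (J : Fin n → ℕ) : p J := by
  induction h : ∑ i, J i generalizing J with
  | zero =>
    have : J = 0 := by
      funext i
      exact (Finset.sum_eq_zero_iff.mp h) i (Finset.mem_univ i)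
    exact this ▸ zero
  | succ k ih =>
    obtain ⟨i, -, hi⟩ : ∃ i ∈ Finset.univ, J i ≠ 0 :=
      Finset.exists_ne_zero_of_sum_ne_zero (by omega)
    -- Truncated subtraction is exact here because `J i ≠ 0`.
    have hJ : J = (J - Pi.single i 1) + Pi.single i 1 := by
      funext j
      rcases eq_or_ne j i with rfl | hj
      · simp only [Pi.add_apply, Pi.sub_apply, Pi.single_eq_same]
        omega
      · simp [hj]
    rw [hJ] at h ⊢
    refine succ _ i (ih _ ?_)
    simp only [Pi.add_apply, Finset.sum_add_distrib, Finset.sum_pi_single', Finset.mem_univ,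
      if_true] at h
    omega

theorem finsum_eq_finsum_comp {α β M : Type*} [AddCommMonoid M] {e : α → β}
    (he : Function.Injective e) {h : β → M} (hh : ∀ b, b ∉ Set.range e → h b = 0) :
    ∑ᶠ b, h b = ∑ᶠ a, h (e a) := by
  rw [← finsum_mem_range he]
  refine finsum_congr fun b => ?_
  by_cases hb : b ∈ Set.range e
  · simp [hb]
  · simp [hb, hh b hb]

/-! ### Formal variational calculus in an abstract jet algebra. -/

/-- An algebra of differential functions, in abstract form: a ring with coordinates `u_J` and
commuting partial derivatives `∂/∂x^i` and `∂/∂u_J`, every element depending on finitely many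
`u_J`. -/
structure JetCalculus (n : ℕ) (A : Type*) [CommRing A] where
  /-- The coordinates `u_J`. -/
  u : (Fin n → ℕ) → A
  /-- The partial derivatives `∂/∂x^i`. -/
  dx : Fin n → Derivation ℤ A A
  /-- The partial derivatives `∂/∂u_J`. -/
  du : (Fin n → ℕ) → Derivation ℤ A A
  dx_dx : ∀ i j F, dx i (dx j F) = dx j (dx i F)
  dx_du : ∀ i J F, dx i (du J F) = du J (dx i F)
  du_du : ∀ J K F, du J (du K F) = du K (du J F)
  dx_u : ∀ i J, dx i (u J) = 0
  du_u_self : ∀ J, du J (u J) = 1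
  du_u_of_ne : ∀ J K, J ≠ K → du J (u K) = 0
  finite_support : ∀ F, {J | du J F ≠ 0}.Finite

namespace JetCalculus

variable {n : ℕ} {A : Type*} [CommRing A] (C : JetCalculus n A)

/-- The finite set of multi-indices `J` for which `F` depends on `u_J`. -/
def order (F : A) : Finset (Fin n → ℕ) := (C.finite_support F).toFinset

theorem du_eq_zero {F : A} {J : Fin n → ℕ} (h : J ∉ C.order F) : C.du J F = 0 := by
  simpa [order] using h

theorem finsum_eq_sum {M : Type*} [AddCommMonoid M] {F : A} {s : Finset (Fin n → ℕ)}
    (hs : C.order F ⊆ s) {φ : (Fin n → ℕ) → M} (hφ : ∀ J, C.du J F = 0 → φ J = 0) :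
    ∑ᶠ J, φ J = ∑ J ∈ s, φ J := by
  refine finsum_eq_sum_of_support_subset _ fun J hJ => ?_
  by_contra hJs
  exact hJ (hφ J (C.du_eq_zero fun h => hJs (hs h)))

/-- A `finsum` with infinite support is `0` by convention, so each splitting of a sum over `J` needs
finiteness; the terms used here vanish together with `F_{u_J}`. -/
theorem finite_support_of {M : Type*} [AddCommMonoid M] (F : A) {φ : (Fin n → ℕ) → M}
    (hφ : ∀ J, C.du J F = 0 → φ J = 0) : (Function.support φ).Finite :=
  (C.finite_support F).subset fun J hJ h => hJ (hφ J h)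

/-- The total derivative `D_i`. -/
def total (i : Fin n) : Derivation ℤ A A :=
  Derivation.mk' (AddMonoidHom.toIntLinearMap
    { toFun := fun F => C.dx i F + ∑ᶠ J, C.u (J + Pi.single i 1) * C.du J F
      map_zero' := by simp
      map_add' := fun F H => by
        simp only [map_add, mul_add]
        rw [finsum_add_distrib (C.finite_support_of F fun J h => by simp [h])
          (C.finite_support_of H fun J h => by simp [h])]
        abel })
    (fun F H => by
      change C.dx i (F * H) + ∑ᶠ J, C.u (J + Pi.single i 1) * C.du J (F * H)
        = F • (C.dx i H + ∑ᶠ J, C.u (J + Pi.single i 1) * C.du J H)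
          + H • (C.dx i F + ∑ᶠ J, C.u (J + Pi.single i 1) * C.du J F)
      simp only [Derivation.leibniz, smul_eq_mul, mul_add]
      rw [finsum_add_distrib (C.finite_support_of H fun J h => by simp [h])
          (C.finite_support_of F fun J h => by simp [h]),
        mul_finsum' _ _ (C.finite_support_of H fun J h => by simp [h]),
        mul_finsum' _ _ (C.finite_support_of F fun J h => by simp [h])]
      simp only [mul_left_comm]
      abel)

theorem total_apply (i : Fin n) (F : A) :
    C.total i F = C.dx i F + ∑ᶠ J, C.u (J + Pi.single i 1) * C.du J F := rfl

theorem total_mul (i : Fin n) (F H : A) :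
    C.total i (F * H) = C.total i F * H + F * C.total i H := by
  rw [Derivation.leibniz, smul_eq_mul, smul_eq_mul]
  ring

theorem total_u (i : Fin n) (J : Fin n → ℕ) : C.total i (C.u J) = C.u (J + Pi.single i 1) := by
  rw [total_apply, C.dx_u, zero_add, finsum_eq_single _ J
    fun K hK => by rw [C.du_u_of_ne _ _ hK, mul_zero], C.du_u_self, mul_one]

/-- A derivation commuting with all partial derivatives commutes with `D_i` up to its action on
the coordinates. -/
theorem derivation_total (δ : Derivation ℤ A A) (hx : ∀ i F, δ (C.dx i F) = C.dx i (δ F))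
    (hu : ∀ J F, δ (C.du J F) = C.du J (δ F)) (i : Fin n) (F : A) :
    δ (C.total i F) = C.total i (δ F) + ∑ᶠ J, δ (C.u (J + Pi.single i 1)) * C.du J F := by
  have hδ : ∀ J, C.du J F = 0 → C.du J (δ F) = 0 := fun J h => by rw [← hu, h, map_zero]
  rw [total_apply, total_apply, map_add, hx, add_assoc, ← finsum_add_distrib
    (C.finite_support_of F fun J h => by simp [hδ J h])
    (C.finite_support_of F fun J h => by simp [h]),
    ← AddMonoidHom.coe_coe δ, AddMonoidHom.map_finsum _
      (C.finite_support_of F fun J h => by simp [h])]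
  congr 1
  refine finsum_congr fun J => ?_
  simp only [AddMonoidHom.coe_coe, Derivation.leibniz, smul_eq_mul, hu]
  ring

theorem dx_total (i j : Fin n) (F : A) : C.dx j (C.total i F) = C.total i (C.dx j F) := by
  rw [C.derivation_total _ (fun _ _ => C.dx_dx _ _ _) (fun _ _ => C.dx_du _ _ _)]
  simp [C.dx_u]

/-- The commutator of `∂/∂u_K` with `D_i` is `∂/∂u_{K - e_i}`, or zero when `K i = 0`. Treating the
two cases in separate lemmas avoids truncated subtraction of indices. -/
theorem du_total_add (i : Fin n) (J : Fin n → ℕ) (F : A) :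
    C.du (J + Pi.single i 1) (C.total i F)
      = C.total i (C.du (J + Pi.single i 1) F) + C.du J F := by
  rw [C.derivation_total _ (fun _ _ => (C.dx_du _ _ _).symm) (fun _ _ => C.du_du _ _ _),
    finsum_eq_single _ J fun K hK => ?_, C.du_u_self, one_mul]
  rw [C.du_u_of_ne _ _ fun h => hK (add_right_cancel h).symm, zero_mul]

theorem du_total_of_notMem (i : Fin n) (J : Fin n → ℕ)
    (hJ : J ∉ Set.range fun K : Fin n → ℕ => K + Pi.single i 1) (F : A) :
    C.du J (C.total i F) = C.total i (C.du J F) := by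
  rw [C.derivation_total _ (fun _ _ => (C.dx_du _ _ _).symm) (fun _ _ => C.du_du _ _ _)]
  rw [finsum_eq_zero_of_forall_eq_zero fun K => ?_, add_zero]
  rw [C.du_u_of_ne _ _ fun h => hJ ⟨K, h.symm⟩, zero_mul]

/-- Summation of the coefficients of `(D_i F)'` against additive maps. -/
theorem finsum_du_total (i : Fin n) (F : A) (φ : (Fin n → ℕ) → A →+ A) :
    ∑ᶠ J, φ J (C.du J (C.total i F))
      = ∑ᶠ J, (φ J (C.total i (C.du J F)) + φ (J + Pi.single i 1) (C.du J F)) := by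
  -- Split off the commutator of `∂/∂u_J` and `D_i`; it lives on the indices `K + e_i`, over which
  -- its sum is reindexed.
  have h : ∀ J, φ J (C.du J (C.total i F)) = φ J (C.total i (C.du J F))
      + φ J (C.du J (C.total i F) - C.total i (C.du J F)) := fun J => by
    rw [← map_add]; congr 1; abel
  rw [finsum_add_distrib (C.finite_support_of F fun J h => by simp [h])
    (C.finite_support_of F fun J h => by simp [h]), finsum_congr h, finsum_add_distrib
      (C.finite_support_of F fun J h => by simp [h])]
  · congr 1
    rw [finsum_eq_finsum_comp (add_left_injective (Pi.single i 1)) fun J hJ => ?_]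
    · refine finsum_congr fun J => ?_
      rw [C.du_total_add, add_sub_cancel_left]
    · rw [C.du_total_of_notMem i J hJ, sub_self, map_zero]
  · refine ((C.finite_support (C.total i F)).union (C.finite_support F)).subset fun J hJ => ?_
    by_contra h'
    simp only [Set.mem_union, Set.mem_ofPred_eq, not_or, not_not] at h'
    exact hJ (by simp [h'.1, h'.2])

/-- The commutator terms `u_{J+e_i+e_j} F_{u_J}` on one side are those produced on the other by
`D_i` acting on the coefficients `u_{J+e_j}`. -/
theorem total_comm (i j : Fin n) (F : A) :
    C.total j (C.total i F) = C.total i (C.total j F) := by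
  conv_lhs => rw [total_apply, C.dx_total]
  conv_rhs => rw [C.total_apply j, map_add, ← AddMonoidHom.coe_coe (C.total i),
    AddMonoidHom.map_finsum _ (C.finite_support_of F fun J h => by simp [h])]
  congr 1
  have := C.finsum_du_total i F fun J => AddMonoidHom.mulLeft (C.u (J + Pi.single j 1))
  simp only [AddMonoidHom.coe_mulLeft] at this
  rw [this]
  refine finsum_congr fun J => ?_
  rw [AddMonoidHom.coe_coe, total_mul, total_u, add_right_comm, add_comm]

/-- The iterated total derivative `D_J`. -/
def iter (J : Fin n → ℕ) : Module.End ℤ A :=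
  ((List.finRange n).map fun i => (C.total i : Module.End ℤ A) ^ J i).prod

theorem commute_total (i j : Fin n) :
    Commute (C.total i : Module.End ℤ A) (C.total j : Module.End ℤ A) :=
  LinearMap.ext fun F => C.total_comm j i F

theorem iter_zero (F : A) : C.iter 0 F = F := by
  simp [iter]

theorem iter_add_single (J : Fin n → ℕ) (i : Fin n) (F : A) :
    C.iter (J + Pi.single i 1) F = C.total i (C.iter J F) := by
  -- The ordered product gains one factor `D_i` if `i` occurs in the list, and only one since there
  -- are no repetitions; commutativity brings it to the front.
  have key : ∀ l : List (Fin n), l.Nodup →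
      (l.map fun j => (C.total j : Module.End ℤ A) ^ (J + Pi.single i 1 : Fin n → ℕ) j).prod =
      (if i ∈ l then (C.total i : Module.End ℤ A) else 1)
        * (l.map fun j => (C.total j : Module.End ℤ A) ^ J j).prod := by
    intro l hl
    induction l with
    | nil => simp
    | cons a l ih =>
      rw [List.nodup_cons] at hl
      rw [List.map_cons, List.prod_cons, List.map_cons, List.prod_cons, ih hl.2]
      rcases eq_or_ne a i with rfl | ha
      · simp [hl.1, pow_succ', mul_assoc]
      · by_cases hi : i ∈ l
        · simp only [Pi.add_apply, Pi.single_eq_of_ne ha, add_zero, hi, if_true, List.mem_cons,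
            or_true, ← mul_assoc]
          rw [((C.commute_total a i).pow_left (J a)).eq]
        · simp [hi, ha, ha.symm]
  have := key _ (List.nodup_finRange n)
  rw [if_pos (List.mem_finRange i)] at this
  exact LinearMap.congr_fun this F

theorem iter_total (J : Fin n → ℕ) (i : Fin n) (F : A) :
    C.iter J (C.total i F) = C.total i (C.iter J F) := by
  induction J using multiIndex_induction with
  | zero => simp [iter_zero]
  | succ J j ih => rw [iter_add_single, iter_add_single, ih, total_comm]

/-- The signed iterated total derivative `(-D)_J`. -/
def signedIter (J : Fin n → ℕ) : Module.End ℤ A := (-1 : ℤ) ^ (∑ i, J i) • C.iter J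

theorem signedIter_zero (F : A) : C.signedIter 0 F = F := by
  simp [signedIter, iter_zero]

theorem signedIter_add_single (J : Fin n → ℕ) (i : Fin n) (F : A) :
    C.signedIter (J + Pi.single i 1) F = -C.total i (C.signedIter J F) := by
  simp only [signedIter, LinearMap.smul_apply, iter_add_single, Pi.add_apply,
    Finset.sum_add_distrib, Finset.sum_pi_single', Finset.mem_univ, if_true, pow_succ, map_zsmul]
  simp

theorem signedIter_total (J : Fin n → ℕ) (i : Fin n) (F : A) :
    C.signedIter J (C.total i F) = C.total i (C.signedIter J F) := by
  simp only [signedIter, LinearMap.smul_apply, iter_total, map_zsmul]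

/-- The Frechet derivative `F'(P)`. -/
def fre (F P : A) : A := ∑ᶠ J, C.du J F * C.iter J P

/-- The adjoint of the Frechet derivative, `F'^*(P) = ∑_J (-D)_J (F_{u_J} P)`. -/
def adj (F P : A) : A := ∑ᶠ J, C.signedIter J (C.du J F * P)

/-- The Euler-Lagrange operator. -/
def euler (L : A) : A := ∑ᶠ J, C.signedIter J (C.du J L)

theorem fre_add (F H P : A) : C.fre (F + H) P = C.fre F P + C.fre H P := by
  rw [fre, fre, fre, ← finsum_add_distrib (C.finite_support_of F fun J h => by simp [h])
    (C.finite_support_of H fun J h => by simp [h])]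
  simp [add_mul]

theorem adj_add (F H P : A) : C.adj (F + H) P = C.adj F P + C.adj H P := by
  rw [adj, adj, adj, ← finsum_add_distrib (C.finite_support_of F fun J h => by simp [h])
    (C.finite_support_of H fun J h => by simp [h])]
  simp [add_mul]

/-- `F ↦ F'(P)` as an additive map. -/
def freHom (P : A) : A →+ A := AddMonoidHom.mk' (fun F => C.fre F P) fun F H => C.fre_add F H P

/-- `F ↦ F'^*(P)` as an additive map. -/
def adjHom (P : A) : A →+ A := AddMonoidHom.mk' (fun F => C.adj F P) fun F H => C.adj_add F H P

theorem fre_mul (F H P : A) : C.fre (F * H) P = F * C.fre H P + H * C.fre F P := by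
  rw [fre, fre, fre, mul_finsum' _ _ (C.finite_support_of H fun J h => by simp [h]),
    mul_finsum' _ _ (C.finite_support_of F fun J h => by simp [h]),
    ← finsum_add_distrib (C.finite_support_of H fun J h => by simp [h])
    (C.finite_support_of F fun J h => by simp [h])]
  simp [add_mul, mul_assoc]

theorem adj_mul (F H P : A) : C.adj (F * H) P = C.adj H (F * P) + C.adj F (H * P) := by
  rw [adj, adj, adj, ← finsum_add_distrib (C.finite_support_of H fun J h => by simp [h])
    (C.finite_support_of F fun J h => by simp [h])]
  refine finsum_congr fun J => ?_
  rw [← map_add, Derivation.leibniz, smul_eq_mul, smul_eq_mul]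
  congr 1
  ring

theorem euler_eq_adj (L : A) : C.euler L = C.adj L 1 := by
  simp [euler, adj]

/-- `E(PG) = G'^*(P) + P'^*(G)`. -/
theorem euler_mul (P G : A) : C.euler (P * G) = C.adj G P + C.adj P G := by
  simp [euler_eq_adj, adj_mul]

theorem fre_total (i : Fin n) (F P : A) : C.fre (C.total i F) P = C.total i (C.fre F P) := by
  have := C.finsum_du_total i F fun J => AddMonoidHom.mulRight (C.iter J P)
  simp only [AddMonoidHom.coe_mulRight] at this
  rw [fre, this, fre, ← AddMonoidHom.coe_coe (C.total i), AddMonoidHom.map_finsum _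
    (C.finite_support_of F fun J h => by simp [h])]
  refine finsum_congr fun J => ?_
  rw [AddMonoidHom.coe_coe, total_mul, iter_add_single]

/-- The adjoint form of `(D_i F)' = D_i ∘ F'`: the shifted terms `-D_i(F_{u_J} P)` cancel `(D_i
F_{u_J}) P` and leave `-F_{u_J} D_i P`. -/
theorem adj_total (i : Fin n) (F P : A) : C.adj (C.total i F) P = -C.adj F (C.total i P) := by
  have := C.finsum_du_total i F fun J =>
    ((C.signedIter J).toAddMonoidHom).comp (AddMonoidHom.mulRight P)
  simp only [AddMonoidHom.comp_apply, AddMonoidHom.coe_mulRight, LinearMap.toAddMonoidHom_coe]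
    at this
  rw [adj, this, adj, ← finsum_neg_distrib]
  refine finsum_congr fun J => ?_
  rw [signedIter_add_single, ← signedIter_total, total_mul, map_add]
  abel

theorem fre_signedIter (K : Fin n → ℕ) (F P : A) :
    C.fre (C.signedIter K F) P = C.signedIter K (C.fre F P) := by
  induction K using multiIndex_induction with
  | zero => simp [signedIter_zero]
  | succ K i ih =>
    rw [signedIter_add_single, signedIter_add_single, ← ih, ← fre_total]
    exact map_neg (C.freHom P) _

theorem adj_signedIter (K : Fin n → ℕ) (F P : A) :
    C.adj (C.signedIter K F) P = C.adj F (C.iter K P) := by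
  induction K using multiIndex_induction generalizing P with
  | zero => simp [signedIter_zero, iter_zero]
  | succ K i ih =>
    rw [signedIter_add_single, iter_add_single, ← iter_total, ← ih, ← neg_eq_iff_eq_neg.mpr
      (C.adj_total i (C.signedIter K F) P)]
    exact map_neg (C.adjHom P) _

/-- Helmholtz: the Frechet derivative of an Euler-Lagrange expression is self-adjoint. -/
theorem fre_euler (L P : A) : C.fre (C.euler L) P = C.adj (C.euler L) P := by
  have hL : ∀ (φ : (Fin n → ℕ) → A), (∀ J, C.du J L = 0 → φ J = 0) →
      ∑ᶠ J, φ J = ∑ J ∈ C.order L, φ J := fun φ hφ => C.finsum_eq_sum subset_rfl hφ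
  have hdu : ∀ J K, C.du J L = 0 → C.du J (C.du K L) = 0 := fun J K h => by
    rw [C.du_du, h, map_zero]
  have hE : C.euler L = ∑ K ∈ C.order L, C.signedIter K (C.du K L) :=
    hL _ fun J h => by simp [h]
  have hf : C.fre (C.euler L) P = ∑ K ∈ C.order L, ∑ J ∈ C.order L,
      C.signedIter K (C.du J (C.du K L) * C.iter J P) := by
    rw [hE]
    refine (map_sum (C.freHom P) _ _).trans (Finset.sum_congr rfl fun K _ => ?_)
    refine (C.fre_signedIter K _ P).trans ?_
    rw [fre, hL _ fun J h => by simp [hdu J K h], map_sum]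
  have ha : C.adj (C.euler L) P = ∑ K ∈ C.order L, ∑ J ∈ C.order L,
      C.signedIter J (C.du J (C.du K L) * C.iter K P) := by
    rw [hE]
    refine (map_sum (C.adjHom P) _ _).trans (Finset.sum_congr rfl fun K _ => ?_)
    refine (C.adj_signedIter K _ P).trans ?_
    rw [adj, hL _ fun J h => by simp [hdu J K h]]
  -- The two double sums differ by exchanging `J` and `K`, so symmetry of the second derivatives
  -- `L_{u_J u_K}` identifies them.
  rw [hf, ha, Finset.sum_comm]
  simp only [C.du_du]

/-- If all total derivatives of `G` vanish at a point, so do those of the multiples of `G`. -/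
theorem eval_iter_mul {R : Type*} [CommRing R] (ev : A →+* R) {G : A}
    (hG : ∀ K, ev (C.iter K G) = 0) (K : Fin n → ℕ) (F : A) : ev (C.iter K (G * F)) = 0 := by
  induction K using multiIndex_induction generalizing G F with
  | zero =>
    have := hG 0
    rw [iter_zero] at this ⊢
    rw [map_mul, this, zero_mul]
  | succ K i ih =>
    -- Both terms of `D_i(GF)` fall under the induction hypothesis: `G · D_i F` with the same `G`,
    -- and `D_i G · F` because `D_i G` inherits the vanishing.
    rw [iter_add_single, ← iter_total, total_mul, map_add, map_add, ih hG, add_zero]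
    refine ih (fun M => ?_) F
    rw [iter_total, ← iter_add_single]
    exact hG _

theorem eval_adj_mul {R : Type*} [CommRing R] (ev : A →+* R) {G : A}
    (hG : ∀ K, ev (C.iter K G) = 0) (F P : A) : ev (C.adj F (G * P)) = 0 := by
  rw [adj, C.finsum_eq_sum (F := F) subset_rfl fun J h => by simp [h], map_sum]
  refine Finset.sum_eq_zero fun J _ => ?_
  rw [signedIter, LinearMap.smul_apply, map_zsmul, mul_left_comm, C.eval_iter_mul ev hG, smul_zero]

/-- If `G` and `WG` are Euler-Lagrange expressions, multiplication by `W` preserves the symmetries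
of `G = 0`. -/
theorem eval_fre_mul {R : Type*} [CommRing R] (ev : A →+* R) {G W : A}
    (hG : ∃ L, C.euler L = G) (hWG : ∃ L, C.euler L = W * G)
    (h : ∀ K, ev (C.iter K G) = 0) {Q : A} (hQ : ev (C.fre G Q) = 0) :
    ev (C.fre G (W * Q)) = 0 := by
  have h1 : C.fre (W * G) Q = C.adj (W * G) Q := by
    obtain ⟨L, hL⟩ := hWG
    rw [← hL, fre_euler]
  have h2 : C.fre G (W * Q) = C.adj G (W * Q) := by
    obtain ⟨L, hL⟩ := hG
    rw [← hL, fre_euler]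
  have h3 : ev G = 0 := by simpa [iter_zero] using h 0
  -- Expanding by the product rules, only `G'^*(WQ) = G'(WQ)` survives evaluation.
  have h4 := congrArg ev h1
  rw [fre_mul, adj_mul, ← h2, map_add, map_add, map_mul, map_mul, hQ, h3, C.eval_adj_mul ev h] at h4
  simpa using h4.symm

theorem adj_of_du_eq_zero {F : A} (hF : ∀ J, J ≠ 0 → C.du J F = 0) (P : A) :
    C.adj F P = C.du 0 F * P := by
  rw [adj, finsum_eq_single _ 0 fun J hJ => by simp [hF J hJ], signedIter_zero]

theorem adj_u (J : Fin n → ℕ) (P : A) : C.adj (C.u J) P = C.signedIter J P := by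
  rw [adj, finsum_eq_single _ J fun K hK => by simp [C.du_u_of_ne K J hK], C.du_u_self, one_mul]

theorem total_of_du_eq_zero {F : A} (hF : ∀ J, J ≠ 0 → C.du J F = 0) (i : Fin n) :
    C.total i F = C.dx i F + C.u (Pi.single i 1) * C.du 0 F := by
  rw [total_apply, finsum_eq_single _ 0 fun J hJ => by simp [hF J hJ], zero_add]

/-- For `P = η - ξ^i u_i` and an Euler-Lagrange expression `G` with `G'(P) + ξ^i D_i G = f G`,
one has `E(PG) = (f + η_u + ξ^i_{x^i}) G`. -/
theorem euler_characteristic_mul {G f η : A} {ξ : Fin n → A} (hG : ∃ L, C.euler L = G)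
    (hη : ∀ J, J ≠ 0 → C.du J η = 0) (hξ : ∀ i J, J ≠ 0 → C.du J (ξ i) = 0)
    (h : C.fre G (η - ∑ i, ξ i * C.u (Pi.single i 1)) + ∑ i, ξ i * C.total i G = f * G) :
    C.euler ((η - ∑ i, ξ i * C.u (Pi.single i 1)) * G)
      = (f + C.du 0 η + ∑ i, C.dx i (ξ i)) * G := by
  have hadj : C.adj (η - ∑ i, ξ i * C.u (Pi.single i 1)) G
      = C.du 0 η * G + ∑ i, (C.dx i (ξ i) * G + ξ i * C.total i G) := by
    refine (map_sub (C.adjHom G) _ _).trans ?_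
    rw [map_sum, sub_eq_add_neg, ← Finset.sum_neg_distrib]
    congr 1
    · exact C.adj_of_du_eq_zero hη G
    · refine Finset.sum_congr rfl fun i _ => ?_
      change -C.adj (ξ i * C.u (Pi.single i 1)) G = _
      rw [adj_mul, adj_u, C.adj_of_du_eq_zero (hξ i)]
      have := C.signedIter_add_single 0 i (ξ i * G)
      rw [zero_add, signedIter_zero] at this
      -- The term `u_i ξ^i_u G` in `D_i(ξ^i G)` cancels the contribution of `(ξ^i)'^*`, leaving only
      -- the explicit derivative `ξ^i_{x^i}`.
      rw [this, total_mul, C.total_of_du_eq_zero (hξ i)]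
      ring
  have hs : C.adj G (η - ∑ i, ξ i * C.u (Pi.single i 1))
      = C.fre G (η - ∑ i, ξ i * C.u (Pi.single i 1)) := by
    obtain ⟨L, hL⟩ := hG
    rw [← hL, fre_euler]
  rw [euler_mul, hadj, hs, eq_sub_of_add_eq h, Finset.sum_add_distrib, ← Finset.sum_mul]
  ring

end JetCalculus

/-! ### Smooth functions of finitely many jet coordinates and their partial derivatives. -/

open Filter Topology

variable {n : ℕ} {Ω : Set (Jet n)}

theorem finiteJet_add_smul (s : Finset (Fin n → ℕ)) (z w : Jet n) (t : ℝ) :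
    finiteJet s (z + t • w) = finiteJet s z + t • finiteJet s w := rfl

/-- Freezing the coordinates outside `s` at their values in `z` gives a continuous section `σ` of
the projection; the preimage of `Ω` under it is a neighbourhood inside the image. -/
theorem isOpen_finiteJet_image (hΩ : IsOpen Ω) (s : Finset (Fin n → ℕ)) :
    IsOpen (finiteJet s '' Ω) := by
  classical
  rw [isOpen_iff_mem_nhds]
  rintro _ ⟨z, hz, rfl⟩
  let σ : (Fin n → ℝ) × (s → ℝ) → Jet n :=
    fun y => (y.1, fun J => if h : J ∈ s then y.2 ⟨J, h⟩ else z.2 J)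
  have hσ : Continuous σ := by
    refine continuous_fst.prodMk (continuous_pi fun J => ?_)
    by_cases h : J ∈ s
    · simp only [h, dif_pos]
      fun_prop
    · simp only [h, dif_neg, not_false_eq_true]
      fun_prop
  have hz' : σ (finiteJet s z) = z := by
    ext J
    · rfl
    · by_cases h : J ∈ s <;> simp [σ, finiteJet, h]
  refine mem_of_superset (hσ.continuousAt.preimage_mem_nhds
    (by rw [hz']; exact hΩ.mem_nhds hz)) fun y hy => ⟨σ y, hy, ?_⟩
  ext J
  · rfl
  · simp [σ, finiteJet]

/-- `f` is given on `Ω` by a smooth function `g` of `x` and the `u_J`, `J ∈ s`. -/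
def IsRepresentedBy (Ω : Set (Jet n)) (f : Jet n → ℝ) (s : Finset (Fin n → ℕ))
    (g : (Fin n → ℝ) × (s → ℝ) → ℝ) : Prop :=
  ContDiffOn ℝ ∞ g (finiteJet s '' Ω) ∧ ∀ z ∈ Ω, f z = g (finiteJet s z)

theorem IsRepresentedBy.contDiffAt {f : Jet n → ℝ} {s : Finset (Fin n → ℕ)}
    {g : (Fin n → ℝ) × (s → ℝ) → ℝ} (hΩ : IsOpen Ω) (h : IsRepresentedBy Ω f s g) {z : Jet n}
    (hz : z ∈ Ω) : ContDiffAt ℝ ∞ g (finiteJet s z) :=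
  h.1.contDiffAt ((isOpen_finiteJet_image hΩ s).mem_nhds ⟨z, hz, rfl⟩)

theorem IsDiffFun.exists_superset {f : Jet n → ℝ} (hf : IsDiffFun Ω f) :
    ∃ s, ∀ t, s ⊆ t → ∃ g, IsRepresentedBy Ω f t g := by
  obtain ⟨s, g, hg, hfg⟩ := hf
  refine ⟨s, fun t hst => ⟨fun y => g (y.1, fun J => y.2 ⟨J, hst J.2⟩), ?_, hfg⟩⟩
  refine hg.comp (f := fun y : (Fin n → ℝ) × (t → ℝ) =>
    ((y.1, fun J => y.2 ⟨J, hst J.2⟩) : (Fin n → ℝ) × (s → ℝ))) (ContDiff.contDiffOn ?_) ?_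
  · exact contDiff_fst.prodMk (contDiff_pi.mpr fun J => (contDiff_apply ℝ ℝ _).comp contDiff_snd)
  · rintro _ ⟨z, hz, rfl⟩
    exact ⟨z, hz, rfl⟩

theorem IsDiffFun.exists_common {f f' : Jet n → ℝ} (hf : IsDiffFun Ω f) (hf' : IsDiffFun Ω f') :
    ∃ s g g', IsRepresentedBy Ω f s g ∧ IsRepresentedBy Ω f' s g' := by
  classical
  obtain ⟨s, hs⟩ := hf.exists_superset
  obtain ⟨s', hs'⟩ := hf'.exists_superset
  obtain ⟨g, hg⟩ := hs _ Finset.subset_union_left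
  obtain ⟨g', hg'⟩ := hs' _ Finset.subset_union_right
  exact ⟨s ∪ s', g, g', hg, hg'⟩

theorem IsDiffFun.congr {f f' : Jet n → ℝ} (hf : IsDiffFun Ω f) (h : ∀ z ∈ Ω, f' z = f z) :
    IsDiffFun Ω f' := by
  obtain ⟨s, g, hg, hfg⟩ := hf
  exact ⟨s, g, hg, fun z hz => (h z hz).trans (hfg z hz)⟩

theorem IsDiffFun.add {f f' : Jet n → ℝ} (hf : IsDiffFun Ω f) (hf' : IsDiffFun Ω f') :
    IsDiffFun Ω (f + f') := by
  obtain ⟨s, g, g', hg, hg'⟩ := hf.exists_common hf'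
  exact ⟨s, g + g', hg.1.add hg'.1, fun z hz => by simp [hg.2 z hz, hg'.2 z hz]⟩

theorem IsDiffFun.mul {f f' : Jet n → ℝ} (hf : IsDiffFun Ω f) (hf' : IsDiffFun Ω f') :
    IsDiffFun Ω (f * f') := by
  obtain ⟨s, g, g', hg, hg'⟩ := hf.exists_common hf'
  exact ⟨s, g * g', hg.1.mul hg'.1, fun z hz => by simp [hg.2 z hz, hg'.2 z hz]⟩

theorem IsDiffFun.neg {f : Jet n → ℝ} (hf : IsDiffFun Ω f) : IsDiffFun Ω (-f) := by
  obtain ⟨s, g, hg, hfg⟩ := hf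
  exact ⟨s, -g, hg.neg, fun z hz => by simp [hfg z hz]⟩

theorem isDiffFun_const (c : ℝ) : IsDiffFun Ω fun _ => c :=
  ⟨∅, fun _ => c, contDiffOn_const, fun _ _ => rfl⟩

theorem isDiffFun_u (J : Fin n → ℕ) : IsDiffFun Ω fun z => z.2 J :=
  ⟨{J}, fun y => y.2 ⟨J, Finset.mem_singleton_self J⟩,
    ((contDiff_apply ℝ ℝ _).comp contDiff_snd).contDiffOn, fun _ _ => rfl⟩

theorem isDiffFun_basePoint {h : (Fin n → ℝ) × ℝ → ℝ} (hh : ContDiffOn ℝ ∞ h (basePoint '' Ω)) :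
    IsDiffFun Ω fun z => h (basePoint z) := by
  refine ⟨{0}, fun y => h (y.1, y.2 ⟨0, Finset.mem_singleton_self 0⟩), ?_, fun _ _ => rfl⟩
  refine hh.comp (f := fun y : (Fin n → ℝ) × (({0} : Finset (Fin n → ℕ)) → ℝ) =>
    (y.1, y.2 ⟨0, Finset.mem_singleton_self 0⟩)) (ContDiff.contDiffOn ?_) ?_
  · exact contDiff_fst.prodMk ((contDiff_apply ℝ ℝ _).comp contDiff_snd)
  · rintro _ ⟨z, hz, rfl⟩
    exact ⟨z, hz, rfl⟩

/-- The partial derivatives with respect to all coordinates of jet space. -/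
def partialD : Fin n ⊕ (Fin n → ℕ) → (Jet n → ℝ) → Jet n → ℝ := Sum.elim partialX partialU

/-- The coordinate functions of jet space. -/
def coordinate : Fin n ⊕ (Fin n → ℕ) → Jet n → ℝ := Sum.elim (fun i z => z.1 i) fun J z => z.2 J

/-- The coordinate directions of jet space. -/
def direction : Fin n ⊕ (Fin n → ℕ) → Jet n :=
  Sum.elim (fun i => (Pi.single i 1, 0)) fun J => (0, Pi.single J 1)

/-- Writing coordinate updates as affine lines lets one chain rule serve both kinds of coordinate.
-/
theorem partialD_eq_deriv (c : Fin n ⊕ (Fin n → ℕ)) (f : Jet n → ℝ) (z : Jet n) :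
    partialD c f z
      = deriv (fun t => f (z + (t - coordinate c z) • direction c)) (coordinate c z) := by
  rcases c with i | J
  · change deriv _ _ = deriv _ (z.1 i)
    congr 1
    funext t
    congr 1
    ext j
    · rcases eq_or_ne j i with rfl | hj
      · simp [coordinate, direction]
      · simp [coordinate, direction, hj]
    · simp [direction]
  · change deriv _ _ = deriv _ (z.2 J)
    congr 1
    funext t
    congr 1
    ext K
    · simp [direction]
    · rcases eq_or_ne K J with rfl | hK
      · simp [coordinate, direction]
      · simp [coordinate, direction, hK]

theorem eventually_line_mem (hΩ : IsOpen Ω) (c : Fin n ⊕ (Fin n → ℕ)) {z : Jet n} (hz : z ∈ Ω) :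
    ∀ᶠ t in 𝓝 (coordinate c z), z + (t - coordinate c z) • direction c ∈ Ω := by
  have hc : Continuous fun t : ℝ => z + (t - coordinate c z) • direction c := by fun_prop
  exact hc.continuousAt.preimage_mem_nhds (hΩ.mem_nhds (by simpa using hz))

/-- Coordinate lines stay in the open set `Ω` for nearby parameters, so the values outside `Ω` do
not matter. -/
theorem partialD_congr (hΩ : IsOpen Ω) {f f' : Jet n → ℝ} (h : ∀ z ∈ Ω, f z = f' z)
    (c : Fin n ⊕ (Fin n → ℕ)) {z : Jet n} (hz : z ∈ Ω) : partialD c f z = partialD c f' z := by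
  rw [partialD_eq_deriv, partialD_eq_deriv]
  refine EventuallyEq.deriv_eq ?_
  filter_upwards [eventually_line_mem hΩ c hz] with t ht using h _ ht

theorem IsRepresentedBy.hasDerivAt {f : Jet n → ℝ} {s : Finset (Fin n → ℕ)}
    {g : (Fin n → ℝ) × (s → ℝ) → ℝ} (hΩ : IsOpen Ω) (h : IsRepresentedBy Ω f s g)
    (c : Fin n ⊕ (Fin n → ℕ)) {z : Jet n} (hz : z ∈ Ω) :
    HasDerivAt (fun t => f (z + (t - coordinate c z) • direction c))
      (fderiv ℝ g (finiteJet s z) (finiteJet s (direction c))) (coordinate c z) := by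
  have hline : HasDerivAt (fun t => finiteJet s z + (t - coordinate c z) • finiteJet s (direction c))
      (finiteJet s (direction c)) (coordinate c z) := by
    simpa using (((hasDerivAt_id (coordinate c z)).sub_const (coordinate c z)).smul_const
      (finiteJet s (direction c))).const_add (finiteJet s z)
  have hg : HasFDerivAt g (fderiv ℝ g (finiteJet s z)) (finiteJet s z) :=
    ((h.contDiffAt hΩ hz).differentiableAt (by simp)).hasFDerivAt
  refine (HasFDerivAt.comp_hasDerivAt_of_eq _ hg hline (by simp)).congr_of_eventuallyEq ?_
  filter_upwards [eventually_line_mem hΩ c hz] with t ht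
  rw [h.2 _ ht, finiteJet_add_smul]
  rfl

theorem IsRepresentedBy.partialD {f : Jet n → ℝ} {s : Finset (Fin n → ℕ)}
    {g : (Fin n → ℝ) × (s → ℝ) → ℝ} (hΩ : IsOpen Ω) (h : IsRepresentedBy Ω f s g)
    (c : Fin n ⊕ (Fin n → ℕ)) :
    IsRepresentedBy Ω (partialD c f) s fun y => fderiv ℝ g y (finiteJet s (direction c)) := by
  refine ⟨?_, fun z hz => ?_⟩
  · exact (h.1.fderiv_of_isOpen (isOpen_finiteJet_image hΩ s) (by simp)).clm_apply contDiffOn_const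
  · rw [partialD_eq_deriv, (h.hasDerivAt hΩ c hz).deriv]

theorem IsDiffFun.partialD {f : Jet n → ℝ} (hΩ : IsOpen Ω) (hf : IsDiffFun Ω f)
    (c : Fin n ⊕ (Fin n → ℕ)) : IsDiffFun Ω (partialD c f) := by
  obtain ⟨s, g, hg⟩ := hf
  exact ⟨s, _, IsRepresentedBy.partialD hΩ hg c⟩

theorem IsDiffFun.differentiableAt {f : Jet n → ℝ} (hΩ : IsOpen Ω) (hf : IsDiffFun Ω f)
    (c : Fin n ⊕ (Fin n → ℕ)) {z : Jet n} (hz : z ∈ Ω) :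
    DifferentiableAt ℝ (fun t => f (z + (t - coordinate c z) • direction c)) (coordinate c z) := by
  obtain ⟨s, g, hg⟩ := hf
  exact (IsRepresentedBy.hasDerivAt hΩ hg c hz).differentiableAt

theorem partialD_add (hΩ : IsOpen Ω) {f f' : Jet n → ℝ} (hf : IsDiffFun Ω f)
    (hf' : IsDiffFun Ω f') (c : Fin n ⊕ (Fin n → ℕ)) {z : Jet n} (hz : z ∈ Ω) :
    partialD c (f + f') z = partialD c f z + partialD c f' z := by
  simp only [partialD_eq_deriv, Pi.add_apply]
  exact deriv_fun_add (hf.differentiableAt hΩ c hz) (hf'.differentiableAt hΩ c hz)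

theorem partialD_mul (hΩ : IsOpen Ω) {f f' : Jet n → ℝ} (hf : IsDiffFun Ω f)
    (hf' : IsDiffFun Ω f') (c : Fin n ⊕ (Fin n → ℕ)) {z : Jet n} (hz : z ∈ Ω) :
    partialD c (f * f') z = f z * partialD c f' z + f' z * partialD c f z := by
  simp only [partialD_eq_deriv, Pi.mul_apply]
  rw [deriv_fun_mul (hf.differentiableAt hΩ c hz) (hf'.differentiableAt hΩ c hz)]
  simp only [sub_self, zero_smul, add_zero]
  ring

theorem partialD_comm (hΩ : IsOpen Ω) {f : Jet n → ℝ} (hf : IsDiffFun Ω f)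
    (c c' : Fin n ⊕ (Fin n → ℕ)) {z : Jet n} (hz : z ∈ Ω) :
    partialD c (partialD c' f) z = partialD c' (partialD c f) z := by
  obtain ⟨s, g, hg⟩ := hf
  have hg : IsRepresentedBy Ω f s g := hg
  have hg2 : ContDiffAt ℝ 2 g (finiteJet s z) :=
    (hg.contDiffAt hΩ hz).of_le (WithTop.coe_le_coe.mpr (le_top : (2 : ℕ∞) ≤ ⊤))
  have hd : DifferentiableAt ℝ (fderiv ℝ g) (finiteJet s z) :=
    (hg2.fderiv_right (m := 1) one_add_one_eq_two.le).differentiableAt one_ne_zero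
  rw [((hg.partialD hΩ c').partialD hΩ c).2 z hz, ((hg.partialD hΩ c).partialD hΩ c').2 z hz]
  beta_reduce
  rw [fderiv_clm_apply hd (differentiableAt_const _), fderiv_clm_apply hd (differentiableAt_const _)]
  simpa using hg2.isSymmSndFDerivAt (by simp) _ _

theorem IsDiffFun.finite_support {f : Jet n → ℝ} (hΩ : IsOpen Ω) (hf : IsDiffFun Ω f) :
    ∃ s : Finset (Fin n → ℕ), ∀ J, J ∉ s → ∀ z ∈ Ω, partialU J f z = 0 := by
  obtain ⟨s, g, hg⟩ := hf
  refine ⟨s, fun J hJ z hz => ((IsRepresentedBy.partialD hΩ hg (Sum.inr J)).2 z hz).trans ?_⟩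
  have : finiteJet s (direction (Sum.inr J)) = 0 := by
    ext K
    · rfl
    · change (Pi.single J 1 : (Fin n → ℕ) → ℝ) K = 0
      exact Pi.single_eq_of_ne (fun h => hJ (by rw [← h]; exact K.2)) 1
  beta_reduce
  rw [this, map_zero]

/-! ### The differential functions on `Ω` as a jet algebra. -/

/-- The ring of differential functions on `Ω`. -/
def diffFun (Ω : Set (Jet n)) : Subring (Ω → ℝ) where
  carrier := {φ | ∃ f, IsDiffFun Ω f ∧ ∀ z : Ω, f z = φ z}
  mul_mem' := by
    rintro φ ψ ⟨f, hf, h⟩ ⟨f', hf', h'⟩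
    exact ⟨f * f', hf.mul hf', fun z => by simp [h, h']⟩
  one_mem' := ⟨_, isDiffFun_const 1, fun _ => rfl⟩
  add_mem' := by
    rintro φ ψ ⟨f, hf, h⟩ ⟨f', hf', h'⟩
    exact ⟨f + f', hf.add hf', fun z => by simp [h, h']⟩
  zero_mem' := ⟨_, isDiffFun_const 0, fun _ => rfl⟩
  neg_mem' := by
    rintro φ ⟨f, hf, h⟩
    exact ⟨-f, hf.neg, fun z => by simp [h]⟩

/-- The restriction of a differential function to `Ω`. -/
def IsDiffFun.restrict {f : Jet n → ℝ} (hf : IsDiffFun Ω f) : diffFun Ω :=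
  ⟨fun z => f z, f, hf, fun _ => rfl⟩

/-- A function on jet space that extends an element of `diffFun Ω`. -/
def extend (φ : diffFun Ω) : Jet n → ℝ := φ.2.choose

theorem isDiffFun_extend (φ : diffFun Ω) : IsDiffFun Ω (extend φ) := φ.2.choose_spec.1

/-- `φ` is the restriction of `f` to `Ω`. -/
def Restricts (f : Jet n → ℝ) (φ : diffFun Ω) : Prop := ∀ z : Ω, f z = φ.1 z

theorem restricts_extend (φ : diffFun Ω) : Restricts (extend φ) φ := φ.2.choose_spec.2

theorem Restricts.isDiffFun {f : Jet n → ℝ} {φ : diffFun Ω} (h : Restricts f φ) :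
    IsDiffFun Ω f :=
  (isDiffFun_extend φ).congr fun z hz => (h ⟨z, hz⟩).trans (restricts_extend φ ⟨z, hz⟩).symm

theorem Restricts.eq {f : Jet n → ℝ} {φ ψ : diffFun Ω} (h : Restricts f φ) (h' : Restricts f ψ) :
    φ = ψ :=
  Subtype.ext (funext fun z => (h z).symm.trans (h' z))

theorem IsDiffFun.restricts {f : Jet n → ℝ} (hf : IsDiffFun Ω f) : Restricts f hf.restrict :=
  fun _ => rfl

theorem Restricts.add {f f' : Jet n → ℝ} {φ φ' : diffFun Ω} (h : Restricts f φ)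
    (h' : Restricts f' φ') : Restricts (f + f') (φ + φ') := fun z => by
  simp [h z, h' z]

theorem Restricts.mul {f f' : Jet n → ℝ} {φ φ' : diffFun Ω} (h : Restricts f φ)
    (h' : Restricts f' φ') : Restricts (f * f') (φ * φ') := fun z => by
  simp [h z, h' z]

/-- The partial derivatives as derivations of the ring of differential functions. -/
def partialDerivation (hΩ : IsOpen Ω) (c : Fin n ⊕ (Fin n → ℕ)) :
    Derivation ℤ (diffFun Ω) (diffFun Ω) :=
  Derivation.mk' (AddMonoidHom.toIntLinearMap (AddMonoidHom.mk'
    -- The chosen extensions need not be additive or multiplicative off `Ω`; `partialD_congr` makes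
    -- the choice harmless.
    (fun φ => ((isDiffFun_extend φ).partialD hΩ c).restrict) fun φ ψ => by
      refine Subtype.ext (funext fun z => ?_)
      change partialD c _ _ = partialD c _ _ + partialD c _ _
      rw [← partialD_add hΩ (isDiffFun_extend φ) (isDiffFun_extend ψ) c z.2]
      exact partialD_congr hΩ (fun w hw => (restricts_extend (φ + ψ) ⟨w, hw⟩).trans
        ((restricts_extend φ).add (restricts_extend ψ) ⟨w, hw⟩).symm) c z.2)) fun φ ψ => by
    refine Subtype.ext (funext fun z => ?_)
    change partialD c _ _ = φ.1 z * partialD c _ _ + ψ.1 z * partialD c _ _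
    rw [← restricts_extend φ, ← restricts_extend ψ,
      ← partialD_mul hΩ (isDiffFun_extend φ) (isDiffFun_extend ψ) c z.2]
    exact partialD_congr hΩ (fun w hw => (restricts_extend (φ * ψ) ⟨w, hw⟩).trans
      ((restricts_extend φ).mul (restricts_extend ψ) ⟨w, hw⟩).symm) c z.2

theorem Restricts.partialD (hΩ : IsOpen Ω) {f : Jet n → ℝ} {φ : diffFun Ω} (h : Restricts f φ)
    (c : Fin n ⊕ (Fin n → ℕ)) : Restricts (partialD c f) (partialDerivation hΩ c φ) := fun z =>
  partialD_congr hΩ (fun w hw => (h ⟨w, hw⟩).trans (restricts_extend φ ⟨w, hw⟩).symm) c z.2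

theorem partialDerivation_comm (hΩ : IsOpen Ω) (c c' : Fin n ⊕ (Fin n → ℕ)) (φ : diffFun Ω) :
    partialDerivation hΩ c (partialDerivation hΩ c' φ)
      = partialDerivation hΩ c' (partialDerivation hΩ c φ) :=
  Subtype.ext <| funext fun z => by
    rw [← ((restricts_extend φ).partialD hΩ c').partialD hΩ c z,
      ← ((restricts_extend φ).partialD hΩ c).partialD hΩ c' z,
      partialD_comm hΩ (isDiffFun_extend φ) c c' z.2]

/-- The calculus of differential functions on an open subset of jet space. -/
def calculus (hΩ : IsOpen Ω) : JetCalculus n (diffFun Ω) where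
  u J := (isDiffFun_u J).restrict
  dx i := partialDerivation hΩ (Sum.inl i)
  du J := partialDerivation hΩ (Sum.inr J)
  dx_dx _ _ _ := partialDerivation_comm hΩ _ _ _
  dx_du _ _ _ := partialDerivation_comm hΩ _ _ _
  du_du _ _ _ := partialDerivation_comm hΩ _ _ _
  dx_u i J := Subtype.ext <| funext fun z => by
    rw [← (isDiffFun_u J).restricts.partialD hΩ _ z]
    exact deriv_const _ _
  du_u_self J := Subtype.ext <| funext fun z => by
    rw [← (isDiffFun_u J).restricts.partialD hΩ _ z]
    simp [partialD, partialU]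
  du_u_of_ne J K h := Subtype.ext <| funext fun z => by
    rw [← (isDiffFun_u K).restricts.partialD hΩ _ z]
    simp [partialD, partialU, Function.update_of_ne h.symm]
  finite_support φ := by
    obtain ⟨s, hs⟩ := (isDiffFun_extend φ).finite_support hΩ
    refine s.finite_toSet.subset fun J hJ => ?_
    by_contra h
    refine hJ (Subtype.ext <| funext fun z => ?_)
    rw [← (restricts_extend φ).partialD hΩ _ z]
    exact hs J h z z.2

/-! ### The concrete operators restrict to the abstract ones. -/

theorem Restricts.partialX (hΩ : IsOpen Ω) {f : Jet n → ℝ} {φ : diffFun Ω} (h : Restricts f φ)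
    (i : Fin n) : Restricts (partialX i f) ((calculus hΩ).dx i φ) :=
  h.partialD hΩ (Sum.inl i)

theorem Restricts.partialU (hΩ : IsOpen Ω) {f : Jet n → ℝ} {φ : diffFun Ω} (h : Restricts f φ)
    (J : Fin n → ℕ) : Restricts (partialU J f) ((calculus hΩ).du J φ) :=
  h.partialD hΩ (Sum.inr J)

/-- Evaluation at a point of `Ω`. -/
def evalAt (z : Ω) : diffFun Ω →+* ℝ := (Pi.evalRingHom (fun _ => ℝ) z).comp (diffFun Ω).subtype

/-- Evaluation at a point commutes with the sum because the family `ψ` itself, not just its value at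
each point, has finite support. -/
theorem restricts_finsum (hΩ : IsOpen Ω) (φ : diffFun Ω) {h : (Fin n → ℕ) → Jet n → ℝ}
    {ψ : (Fin n → ℕ) → diffFun Ω} (hψ : ∀ J, (calculus hΩ).du J φ = 0 → ψ J = 0)
    (hh : ∀ J, Restricts (h J) (ψ J)) : Restricts (fun z => ∑ᶠ J, h J z) (∑ᶠ J, ψ J) := fun z => by
  refine Eq.trans (finsum_congr fun J => hh J z) ?_
  exact ((evalAt z).toAddMonoidHom.map_finsum
    ((calculus hΩ).finite_support_of φ hψ)).symm

theorem Restricts.totalDeriv (hΩ : IsOpen Ω) {f : Jet n → ℝ} {φ : diffFun Ω} (h : Restricts f φ)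
    (i : Fin n) : Restricts (totalDeriv i f) ((calculus hΩ).total i φ) :=
  (h.partialX hΩ i).add (restricts_finsum hΩ φ (fun J hJ => by rw [hJ, mul_zero])
    fun J => (isDiffFun_u (J + Pi.single i 1)).restricts.mul (h.partialU hΩ J))

theorem Restricts.iterTotalDeriv (hΩ : IsOpen Ω) {f : Jet n → ℝ} {φ : diffFun Ω}
    (h : Restricts f φ) (J : Fin n → ℕ) :
    Restricts (iterTotalDeriv J f) ((calculus hΩ).iter J φ) := by
  rw [JetPDE.iterTotalDeriv, JetCalculus.iter]
  induction List.finRange n with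
  | nil => exact h
  | cons i l ih =>
    rw [List.foldr_cons, List.map_cons, List.prod_cons, Module.End.mul_apply]
    generalize J i = k
    induction k with
    | zero => exact ih
    | succ k ihk =>
      rw [Function.iterate_succ_apply', pow_succ', Module.End.mul_apply]
      exact ihk.totalDeriv hΩ i

theorem Restricts.frechet (hΩ : IsOpen Ω) {G P : Jet n → ℝ} {φ ψ : diffFun Ω}
    (hG : Restricts G φ) (hP : Restricts P ψ) :
    Restricts (frechet G P) ((calculus hΩ).fre φ ψ) :=
  restricts_finsum hΩ φ (fun J hJ => by rw [hJ, zero_mul])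
    fun J => (hG.partialU hΩ J).mul (hP.iterTotalDeriv hΩ J)

theorem Restricts.eulerOp (hΩ : IsOpen Ω) {L : Jet n → ℝ} {φ : diffFun Ω} (hL : Restricts L φ) :
    Restricts (eulerOp L) ((calculus hΩ).euler φ) :=
  restricts_finsum hΩ φ (fun J hJ => by rw [hJ, map_zero]) fun J z => by
    rw [((hL.partialU hΩ J).iterTotalDeriv hΩ J) z]
    rw [JetCalculus.signedIter]
    -- The abstract sign is an integer scalar and the concrete one a real factor; parity reconciles
    -- them.
    rcases Nat.even_or_odd (∑ i, J i) with h | h <;> simp [h.neg_one_pow]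

theorem Restricts.sum {ι : Type*} {s : Finset ι} {f : ι → Jet n → ℝ} {φ : ι → diffFun Ω}
    (h : ∀ i, Restricts (f i) (φ i)) :
    Restricts (fun z => ∑ i ∈ s, f i z) (∑ i ∈ s, φ i) := fun z =>
  (Finset.sum_congr rfl fun i _ => h i z).trans (map_sum (evalAt z) _ _).symm

theorem Restricts.sub {f f' : Jet n → ℝ} {φ φ' : diffFun Ω} (h : Restricts f φ)
    (h' : Restricts f' φ') : Restricts (fun z => f z - f' z) (φ - φ') := fun z => by
  simp [h z, h' z]

theorem partialU_basePoint {J : Fin n → ℕ} (hJ : J ≠ 0) (h : (Fin n → ℝ) × ℝ → ℝ) :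
    partialU J (fun z => h (basePoint z)) = 0 := by
  funext z
  simp [partialU, basePoint, Function.update_of_ne hJ.symm]

theorem Restricts.exists_euler (hΩ : IsOpen Ω) {G : Jet n → ℝ} {φ : diffFun Ω}
    (h : Restricts G φ) (hG : IsEulerLagrange Ω G) : ∃ L, (calculus hΩ).euler L = φ := by
  obtain ⟨L, hL, hLG⟩ := hG
  exact ⟨hL.restrict, Restricts.eq (hL.restricts.eulerOp hΩ)
    fun z => (hLG z z.2).trans (h z)⟩

end JetPDE

end

/-! ### Proof of the proposition. -/

theorem proposition3p5 {n : ℕ} (Ω : Set (JetPDE.Jet n)) (hΩ : IsOpen Ω)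
    (G : JetPDE.Jet n → ℝ) (hG : JetPDE.IsDiffFun Ω G) (hEL : JetPDE.IsEulerLagrange Ω G)
    (ξ : Fin n → (Fin n → ℝ) × ℝ → ℝ) (η : (Fin n → ℝ) × ℝ → ℝ)
    (hX : JetPDE.IsLiePointSymmetry Ω G ξ η)
    (hnonvar : ¬ JetPDE.IsVariationalSymmetry Ω G (JetPDE.pointCharacteristic ξ η))
    (f : JetPDE.Jet n → ℝ) (hf : JetPDE.IsDiffFun Ω f)
    (hfG : ∀ z ∈ Ω, JetPDE.prolongation ξ η G z = f z * G z) :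
    JetPDE.IsVariationalIntegratingFactor Ω G (JetPDE.integratingFactor ξ η f) ∧
      (¬ JetPDE.IsConstOn Ω (JetPDE.integratingFactor ξ η f) →
        JetPDE.IsNontrivialMultiplicativeRecursionOperator Ω G
          (JetPDE.integratingFactor ξ η f)) := by
  open JetPDE in
  obtain ⟨hξ, hη, hP⟩ := hX
  have rG := hG.restricts
  have rf := hf.restricts
  have rη := (isDiffFun_basePoint hη).restricts
  have rξ := fun i => (isDiffFun_basePoint (hξ i)).restricts
  set C := calculus hΩ
  set γ := hG.restrict
  set φ := hf.restrict
  set e := (isDiffFun_basePoint hη).restrict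
  set x := fun i => (isDiffFun_basePoint (hξ i)).restrict
  have hγ : ∃ L, C.euler L = γ := rG.exists_euler hΩ hEL
  have rP : Restricts (pointCharacteristic ξ η) (e - ∑ i, x i * C.u (Pi.single i 1)) :=
    rη.sub (Restricts.sum fun i => (rξ i).mul (isDiffFun_u _).restricts)
  have rW : Restricts (integratingFactor ξ η f) (φ + C.du 0 e + ∑ i, C.dx i (x i)) :=
    (rf.add (rη.partialU hΩ 0)).add (Restricts.sum fun i => (rξ i).partialX hΩ i)
  have du_zero : ∀ {h : (Fin n → ℝ) × ℝ → ℝ} {ψ : diffFun Ω},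
      Restricts (fun z => h (basePoint z)) ψ → ∀ J, J ≠ 0 → C.du J ψ = 0 := fun hψ J hJ => by
    have := hψ.partialU hΩ J
    rw [partialU_basePoint hJ] at this
    exact this.eq fun _ => rfl
  have key := C.euler_characteristic_mul (f := φ) hγ (du_zero rη) (fun i => du_zero (rξ i))
    (Restricts.eq ((rG.frechet hΩ rP).add
      (Restricts.sum fun i => (rξ i).mul (rG.totalDeriv hΩ i)))
      fun z => (hfG z z.2).trans ((rf.mul rG) z))
  have rPG := (rP.mul rG).eulerOp hΩ
  have hPG : ∀ z ∈ Ω, eulerOp (fun y => pointCharacteristic ξ η y * G y) z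
      = integratingFactor ξ η f z * G z := fun z hz =>
    (rPG ⟨z, hz⟩).trans ((congrArg (fun ψ => ψ.1 ⟨z, hz⟩) key).trans ((rW.mul rG) ⟨z, hz⟩).symm)
  -- The Lagrangian left implicit is `P G`.
  refine ⟨⟨rW.isDiffFun, ?_, _, (rP.mul rG).isDiffFun, hPG⟩, fun hW => ⟨⟨rW.isDiffFun,
    fun Q hQ => ?_⟩, hW⟩⟩
  · by_contra! h
    exact hnonvar ⟨hP, fun z hz => by rw [hPG z hz, h z hz, zero_mul]⟩
  · have rQ := hQ.1.restricts
    refine ⟨(rW.mul rQ).isDiffFun, fun z hz => ?_⟩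
    refine (rG.frechet hΩ (rW.mul rQ) ⟨z, hz.1⟩).trans ?_
    exact C.eval_fre_mul (evalAt ⟨z, hz.1⟩) hγ ⟨_, key⟩
      (fun K => (rG.iterTotalDeriv hΩ K ⟨z, hz.1⟩).symm.trans (hz.2 K))
      ((rG.frechet hΩ rQ ⟨z, hz.1⟩).symm.trans (hQ.2 z hz))
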